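/- Let $\alpha>0$, $\lambda>1/\alpha$ and $\overline{\gamma}>0$ be real numbers, put $$\zeta=\left(\frac{\Gamma(1+\frac1\alpha)\,\Gamma(\lambda-\frac1\alpha)}{\Gamma(\lambda)}\right)^{\alpha},$$ and let $$f_\Gamma(\gamma)=\frac{\alpha\lambda\zeta}{\overline{\gamma}^{\alpha}}\,\gamma^{\alpha-1}\left(1+\frac{\zeta}{\overline{\gamma}^{\alpha}}\gamma^{\alpha}\right)^{-(\lambda+1)},\qquad \gamma>0,$$ be the probability density of the instantaneous signal-to-noise ratio of the $\alpha$-Lomax fading channel with average signal-to-noise ratio $\overline{\gamma}$. Then $\gamma\mapsto\ln(1+\gamma)f_\Gamma(\gamma)$ is integrable on $(0,\infty)$, and the ergodic (average) channel capacity $\overline{C}=\frac{1}{\ln 2}\int_0^\infty \ln(1+\gamma)\,f_\Gamma(\gamma)\,d\gamma$ satisfies $$\overline{C}=\frac{\alpha}{\ln(2)\,\Gamma(\lambda)}\;\mathsf{H}^{3,2}_{3,3}\!\left[\frac{\zeta}{\overline{\gamma}^{\alpha}}\,\middle|\,\begin{matrix}(1-\lambda,1),(0,\alpha),(1,\alpha)\\(1,1),(0,\alpha),(0,\alpha)\end{matrix}\right].$$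 Here $\mathsf{H}$ is the Fox H-function $$\mathsf{H}^{m,n}_{p,q}\!\left[z\,\middle|\,\begin{matrix}(a_1,A_1),\dots,(a_p,A_p)\\(b_1,B_1),\dots,(b_q,B_q)\end{matrix}\right]=\frac{1}{2\pi i}\int_{c-i\infty}^{c+i\infty}\frac{\prod_{j=1}^m\Gamma(b_j+B_js)\prod_{j=1}^n\Gamma(1-a_j-A_js)}{\prod_{j=n+1}^p\Gamma(a_j+A_js)\prod_{j=m+1}^q\Gamma(1-b_j-B_js)}\,z^{-s}\,ds,$$ where $c\in\mathbb{R}$ is such that all poles of the $\Gamma(b_j+B_js)$, $1\le j\le m$, lie to the left and all poles of the $\Gamma(1-a_j-A_js)$, $1\le j\le n$, lie to the right of the line $\operatorname{Re}s=c$. For the parameters above such $c$ exist, and for every such $c$ the integral converges absolutely, with a value that does not depend on $c$. -/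

import Mathlib

open MeasureTheory Set

noncomputable section

/-- The Mellin–Barnes kernel of the Fox H-function `H^{m,n}_{p,q}` with upper parameters
`a j = (a_j, A_j)` and lower parameters `b j = (b_j, B_j)`:
`∏_{j ≤ m} Γ(b_j + B_j s) ∏_{j ≤ n} Γ(1 - a_j - A_j s)` divided by
`∏_{j > n} Γ(a_j + A_j s) ∏_{j > m} Γ(1 - b_j - B_j s)` (indices start at `0` in the code).
At a pole of a Gamma factor of the denominator the quotient is `0`, which is the correct value
of the entire function `1 / Γ` there. -/
def foxHKernel {p q : ℕ} (m n : ℕ) (a : Fin p → ℂ × ℝ) (b : Fin q → ℂ × ℝ) (s : ℂ) : ℂ :=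
  ((∏ j : Fin q with j.val < m, Complex.Gamma ((b j).1 + (b j).2 * s)) *
      ∏ j : Fin p with j.val < n, Complex.Gamma (1 - (a j).1 - (a j).2 * s)) /
    ((∏ j : Fin p with n ≤ j.val, Complex.Gamma ((a j).1 + (a j).2 * s)) *
      ∏ j : Fin q with m ≤ j.val, Complex.Gamma (1 - (b j).1 - (b j).2 * s))

/-- The vertical line `Re s = c` separates the poles of the Gamma factors in the numerator:
the poles of `Γ(b_j + B_j s)`, `j ≤ m`, lie to its left and
those of `Γ(1 - a_j - A_j s)`, `j ≤ n`, to its right. -/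
def FoxHSeparates {p q : ℕ} (m n : ℕ) (a : Fin p → ℂ × ℝ) (b : Fin q → ℂ × ℝ) (c : ℝ) : Prop :=
  (∀ j : Fin q, j.val < m → ∀ (k : ℕ) (s : ℂ), (b j).1 + (b j).2 * s = -(k : ℂ) → s.re < c) ∧
    ∀ j : Fin p, j.val < n → ∀ (k : ℕ) (s : ℂ), 1 - (a j).1 - (a j).2 * s = -(k : ℂ) → c < s.re

/-- The integrand (in the parameter `t`) of the Mellin–Barnes integral along `s = c + i t`;
the final factor `i` is `ds/dt`. -/
def foxHIntegrand {p q : ℕ} (m n : ℕ) (a : Fin p → ℂ × ℝ) (b : Fin q → ℂ × ℝ) (z : ℂ)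
    (c t : ℝ) : ℂ :=
  foxHKernel m n a b (c + t * Complex.I) * z ^ (-((c : ℂ) + t * Complex.I)) * Complex.I

/-- `H` is the value at `z` of the Fox H-function `H^{m,n}_{p,q}[z | a; b]`: some vertical line
separates the two families of poles and, along every such line, the Mellin–Barnes integral
`(2πi)⁻¹ ∫ foxHKernel(s) z^{-s} ds` converges absolutely with value `H`. -/
def HasFoxH {p q : ℕ} (m n : ℕ) (a : Fin p → ℂ × ℝ) (b : Fin q → ℂ × ℝ) (z H : ℂ) : Prop :=
  (∃ c : ℝ, FoxHSeparates m n a b c) ∧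
    ∀ c : ℝ, FoxHSeparates m n a b c →
      Integrable (foxHIntegrand m n a b z c) ∧
        (2 * (Real.pi : ℂ) * Complex.I)⁻¹ * ∫ t : ℝ, foxHIntegrand m n a b z c t = H

open Classical in
/-- The Fox H-function `H^{m,n}_{p,q}[z | a; b]` (`0` if the defining integral does not exist). -/
def foxH {p q : ℕ} (m n : ℕ) (a : Fin p → ℂ × ℝ) (b : Fin q → ℂ × ℝ) (z : ℂ) : ℂ :=
  if h : ∃ H, HasFoxH m n a b z H then h.choose else 0

theorem HasFoxH.unique {p q m n : ℕ} {a : Fin p → ℂ × ℝ} {b : Fin q → ℂ × ℝ} {z H H' : ℂ}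
    (h : HasFoxH m n a b z H) (h' : HasFoxH m n a b z H') : H = H' := by
  obtain ⟨c, hc⟩ := h.1
  exact (h.2 c hc).2.symm.trans (h'.2 c hc).2

theorem HasFoxH.foxH_eq {p q m n : ℕ} {a : Fin p → ℂ × ℝ} {b : Fin q → ℂ × ℝ} {z H : ℂ}
    (h : HasFoxH m n a b z H) : foxH m n a b z = H := by
  have hex : ∃ H, HasFoxH m n a b z H := ⟨H, h⟩
  rw [foxH, dif_pos hex]
  exact hex.choose_spec.unique h

/-- `ζ = (Γ(1 + 1/α) Γ(λ - 1/α) / Γ(λ))^α`. -/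
def alphaLomaxZeta (α lam : ℝ) : ℝ :=
  (Real.Gamma (1 + 1 / α) * Real.Gamma (lam - 1 / α) / Real.Gamma lam) ^ α

/-- The density, at `γ > 0`, of the instantaneous SNR of the `α`-Lomax fading channel with shape
parameter `lam` and average SNR `gbar`. -/
def alphaLomaxSNRPdf (α lam gbar γ : ℝ) : ℝ :=
  α * lam * alphaLomaxZeta α lam / gbar ^ α * γ ^ (α - 1) *
    (1 + alphaLomaxZeta α lam / gbar ^ α * γ ^ α) ^ (-(lam + 1))

/-- The average (ergodic) channel capacity, in bit/s/Hz, of a channel whose instantaneous SNR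
has density `f` on `(0, ∞)`. -/
def ergodicCapacity (f : ℝ → ℝ) : ℝ :=
  1 / Real.log 2 * ∫ γ in Ioi (0 : ℝ), Real.log (1 + γ) * f γ

end

/-! The Mellin transform of `log (1 + x)` on `-1 < Re s < 0` is `π / (s sin πs)`
(`hasMellin_log_one_add`). Mellin inversion, followed by `s ↦ -αs`, writes `log (1 + x)` as a
vertical integral of `x ^ (αs)` over `Re s = c` with `0 < c < 1/α`. Multiply by the density and
exchange the integrals (`integrable_logKernel_mul_lomax`). The inner integral is a fractional moment
of the density, `w ^ (-s) Γ(1+s) Γ(λ-s) / Γ(λ)` with `w = ζ / γ̄ ^ α` (`integral_cpow_mul_lomax`).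
By the reflection formula the product of the two transforms is the Fox kernel up to `Γ(λ)`
(`foxHKernel_capacity`). The separating lines are exactly `0 < c < 1/α`, so the argument covers
every admissible `c` and gives the same value on each. -/

/-! ### The Beta integral on the half-line -/

theorem hasMellin_one_add_rpow_neg {a : ℝ} {s : ℂ} (hs : 0 < s.re) (hsa : s.re < a) :
    HasMellin (fun x : ℝ => (((1 + x) ^ (-a) : ℝ) : ℂ)) s
      (Complex.Gamma s * Complex.Gamma (a - s) / Complex.Gamma a) := by
  have hv : 0 < ((a : ℂ) - s).re := by simpa using hsa
  -- The substitution `u = x / (1 + x)` carries the half-line to `(0, 1)` and the Mellin integral to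
  -- the Beta integral `B(s, a - s)`.
  let φ : ℝ → ℝ := fun x => 1 - (1 + x)⁻¹
  let φ' : ℝ → ℝ := fun x => ((1 + x) ^ 2)⁻¹
  let g : ℝ → ℂ := fun x => (x : ℂ) ^ (s - 1) * (1 - (x : ℂ)) ^ ((a : ℂ) - s - 1)
  have hφ' : ∀ x ∈ Ioi (0 : ℝ), HasDerivWithinAt φ (φ' x) (Ioi 0) x := by
    intro x hx
    have hx0 : (1 + x) ≠ 0 := by have := mem_Ioi.1 hx; positivity
    have := (((hasDerivAt_id x).const_add 1).inv hx0).const_sub 1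
    convert! this.hasDerivWithinAt using 1
    simp [φ']
    ring
  have hinj : InjOn φ (Ioi 0) := by
    intro x _ y _ h
    simpa [φ] using h
  have himg : φ '' Ioi 0 = Ioo 0 1 := by
    ext y
    constructor
    · rintro ⟨x, hx, rfl⟩
      have hx : 0 < x := hx
      refine ⟨?_, ?_⟩
      · simpa [φ] using inv_lt_one_of_one_lt₀ (by linarith : 1 < 1 + x)
      · simp only [φ]; linarith [inv_pos.2 (by linarith : 0 < 1 + x)]
    · rintro ⟨h0, h1⟩
      refine ⟨(1 - y)⁻¹ - 1, ?_, by simp [φ]⟩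
      have := (one_lt_inv₀ (by linarith : 0 < 1 - y)).2 (by linarith)
      simpa using this
  have hcongr : ∀ x ∈ Ioi (0 : ℝ), |φ' x| • g (φ x) =
      (x : ℂ) ^ (s - 1) • (((1 + x) ^ (-a) : ℝ) : ℂ) := by
    intro x hx
    have hx : 0 < x := hx
    have h1 : 0 < 1 + x := by linarith
    have h1c : ((1 + x : ℝ) : ℂ) ≠ 0 := by exact_mod_cast h1.ne'
    have e1 : φ x = x * (1 + x)⁻¹ := by simp only [φ]; field_simp; ring
    have e2 : (1 : ℂ) - (φ x : ℂ) = (((1 + x)⁻¹ : ℝ) : ℂ) := by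
      simp only [φ]; push_cast; ring
    have hinv : (((1 + x)⁻¹ : ℝ) : ℂ) ≠ 0 := by exact_mod_cast (inv_pos.2 h1).ne'
    -- The exponents add up to `a - 2`; the surplus `(1 + x) ^ 2` cancels against the Jacobian `φ'`.
    have e3 : (((1 + x)⁻¹ : ℝ) : ℂ) ^ (s - 1) * (((1 + x)⁻¹ : ℝ) : ℂ) ^ ((a : ℂ) - s - 1) =
        (((1 + x) ^ (-a) : ℝ) : ℂ) * ((1 + x : ℝ) : ℂ) ^ 2 := by
      rw [← Complex.cpow_add _ _ hinv, show s - 1 + ((a : ℂ) - s - 1) = ((a - 2 : ℝ) : ℂ) by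
        push_cast; ring, ← Complex.ofReal_cpow (inv_pos.2 h1).le, Real.inv_rpow h1.le,
        ← Real.rpow_neg h1.le, show -(a - 2) = -a + (2 : ℕ) by push_cast; ring,
        Real.rpow_add_natCast h1.ne']
      push_cast; rfl
    simp only [g]
    rw [e2, e1, Complex.ofReal_mul, Complex.mul_cpow_ofReal_nonneg hx.le (inv_pos.2 h1).le,
      mul_assoc, e3, abs_of_pos (by positivity), Complex.real_smul, smul_eq_mul]
    simp only [φ']
    push_cast at h1c ⊢
    field_simp
  have hint : IntegrableOn g (Ioo 0 1) :=
    ((intervalIntegrable_iff_integrableOn_Ioo_of_le zero_le_one).1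
      (Complex.betaIntegral_convergent hs hv))
  constructor
  · rw [← himg, integrableOn_image_iff_integrableOn_abs_deriv_smul measurableSet_Ioi hφ' hinj] at hint
    exact hint.congr_fun hcongr measurableSet_Ioi
  · rw [mellin, ← setIntegral_congr_fun measurableSet_Ioi hcongr,
      ← integral_image_eq_integral_abs_deriv_smul measurableSet_Ioi hφ' hinj, himg,
      ← integral_Ioc_eq_integral_Ioo, ← intervalIntegral.integral_of_le zero_le_one]
    have := Complex.betaIntegral_eq_Gamma_mul_div s (a - s) hs hv
    rwa [add_sub_cancel] at this

/-! ### Mellin transform of `log (1 + x)` -/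

/-- Apply `log y ≤ y - 1` to `y = (1 + x) ^ ε` and use subadditivity of `x ^ ε`. Taking `ε = 1`
controls the behaviour at `0`, a small `ε` that at infinity. -/
theorem log_one_add_le_rpow_div {x ε : ℝ} (hx : 0 ≤ x) (hε : 0 < ε) (hε1 : ε ≤ 1) :
    Real.log (1 + x) ≤ x ^ ε / ε := by
  have h : (1 + x) ^ ε ≤ 1 + x ^ ε := by
    simpa using Real.rpow_add_le_add_rpow zero_le_one hx hε.le hε1
  have h1 : 0 < 1 + x := by linarith
  rw [le_div_iff₀ hε, mul_comm, ← Real.log_rpow h1]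
  have := Real.log_le_sub_one_of_pos (Real.rpow_pos_of_pos h1 ε)
  linarith

theorem norm_log_one_add_le_rpow_div {x ε : ℝ} (hx : 0 ≤ x) (hε : 0 < ε) (hε1 : ε ≤ 1) :
    ‖Real.log (1 + x)‖ ≤ ε⁻¹ * ‖x ^ ε‖ := by
  rw [Real.norm_of_nonneg (Real.log_nonneg (by linarith)),
    Real.norm_of_nonneg (Real.rpow_nonneg hx _), inv_mul_eq_div]
  exact log_one_add_le_rpow_div hx hε hε1

theorem mellinConvergent_log_one_add {s : ℂ} (hs : -1 < s.re) (hs0 : s.re < 0) :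
    MellinConvergent (fun x : ℝ => ((Real.log (1 + x) : ℝ) : ℂ)) s := by
  refine mellinConvergent_of_isBigO_rpow (a := s.re / 2) (b := -1) ?_ ?_ (by linarith) ?_ hs
  · refine ContinuousOn.locallyIntegrableOn ?_ measurableSet_Ioi
    intro x hx
    have hx : 0 < x := hx
    have : (1 + x) ≠ 0 := by linarith
    exact (Complex.continuous_ofReal.continuousAt.comp
      (ContinuousAt.log (by fun_prop) this)).continuousWithinAt
  · refine Asymptotics.IsBigO.of_bound (-(s.re / 2))⁻¹ ?_
    filter_upwards [Filter.eventually_ge_atTop 0] with x hx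
    rw [Complex.norm_real]
    exact norm_log_one_add_le_rpow_div hx (by linarith) (by linarith)
  · refine Asymptotics.IsBigO.of_bound 1⁻¹ ?_
    filter_upwards [self_mem_nhdsWithin] with x hx
    rw [Complex.norm_real, neg_neg]
    exact norm_log_one_add_le_rpow_div (le_of_lt hx) one_pos le_rfl

theorem norm_log_one_add_mul_cpow_le {s : ℂ} {x ε : ℝ} (hx : 0 < x) (hε : 0 < ε) (hε1 : ε ≤ 1) :
    ‖((Real.log (1 + x) : ℝ) : ℂ) * ((x : ℂ) ^ s / s)‖ ≤ (ε * ‖s‖)⁻¹ * x ^ (ε + s.re) := by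
  rw [norm_mul, norm_div, Complex.norm_cpow_eq_rpow_re_of_pos hx, Complex.norm_real,
    Real.rpow_add hx]
  have := norm_log_one_add_le_rpow_div hx.le hε hε1
  rw [Real.norm_of_nonneg (Real.rpow_nonneg hx.le ε)] at this
  calc _ ≤ (ε⁻¹ * x ^ ε) * (x ^ s.re / ‖s‖) := by gcongr
    _ = _ := by rw [mul_inv]; ring

/-- Integration by parts against `x ^ s / s` leaves `-1/s` times the Beta integral at `s + 1` with
`a = 1`, that is, `Γ(s+1) Γ(-s)`, which reflection evaluates. The boundary terms vanish by the
logarithmic bound with `ε = 1` at `0` and `ε = -Re s / 2` at infinity. -/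
theorem hasMellin_log_one_add {s : ℂ} (hs : -1 < s.re) (hs0 : s.re < 0) :
    HasMellin (fun x : ℝ => ((Real.log (1 + x) : ℝ) : ℂ)) s
      (Real.pi / (s * Complex.sin (Real.pi * s))) := by
  have hconv := mellinConvergent_log_one_add hs hs0
  refine ⟨hconv, ?_⟩
  have hsne : s ≠ 0 := by rintro rfl; simp at hs0
  obtain ⟨hbc, hbeta⟩ :=
    hasMellin_one_add_rpow_neg (a := 1) (s := s + 1) (by simp; linarith) (by simpa)
  have hderU : ∀ x ∈ Ioi (0 : ℝ), HasDerivAt (fun x : ℝ => ((Real.log (1 + x) : ℝ) : ℂ))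
      (((1 + x) ^ (-1 : ℝ) : ℝ) : ℂ) x := by
    intro x hx
    have hx : 0 < x := hx
    have := (((hasDerivAt_id x).const_add 1).log (by simp; positivity)).ofReal_comp
    convert! this using 1
    rw [Real.rpow_neg_one]; simp
  have hderV : ∀ x ∈ Ioi (0 : ℝ), HasDerivAt (fun x : ℝ => (x : ℂ) ^ s / s)
      ((x : ℂ) ^ (s - 1)) x := by
    intro x hx
    simpa using hasDerivAt_ofReal_cpow_const' (r := s - 1) (ne_of_gt hx)
      (by intro h; apply hsne; linear_combination h)
  have hparts := integral_Ioi_mul_deriv_eq_deriv_mul (a' := 0) (b' := 0) hderU hderV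
    (hconv.congr_fun (fun x _ => by simp [mul_comm]) measurableSet_Ioi)
    ((hbc.div_const s).congr_fun (fun x _ => by simp; ring) measurableSet_Ioi) ?_ ?_
  · have e1 : mellin (fun x : ℝ => ((Real.log (1 + x) : ℝ) : ℂ)) s =
        ∫ x in Ioi (0 : ℝ), ((Real.log (1 + x) : ℝ) : ℂ) * (x : ℂ) ^ (s - 1) := by
      simp only [mellin, smul_eq_mul, mul_comm]
    have e2 : ∫ x in Ioi (0 : ℝ), (((1 + x) ^ (-1 : ℝ) : ℝ) : ℂ) * ((x : ℂ) ^ s / s) =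
        mellin (fun x : ℝ => (((1 + x) ^ (-1 : ℝ) : ℝ) : ℂ)) (s + 1) / s := by
      rw [mellin, ← integral_div]
      refine integral_congr_ae (Filter.Eventually.of_forall fun x => ?_)
      simp only [add_sub_cancel_right, smul_eq_mul]
      ring
    rw [e1, hparts, e2, hbeta, Complex.ofReal_one, Complex.Gamma_mul_Gamma_one_sub,
      Complex.Gamma_one, show (Real.pi : ℂ) * (s + 1) = Real.pi * s + Real.pi by ring,
      Complex.sin_add_pi, div_neg, div_one, sub_self, zero_sub, neg_div, neg_neg, div_div, mul_comm s]
  · refine squeeze_zero_norm' (a := fun x => (1 * ‖s‖)⁻¹ * x ^ (1 + s.re)) ?_ ?_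
    · filter_upwards [self_mem_nhdsWithin] with x hx
      exact norm_log_one_add_mul_cpow_le hx one_pos le_rfl
    · have h : 0 < 1 + s.re := by linarith
      have := ((Real.continuousAt_rpow_const 0 (1 + s.re) (Or.inr h.le)).tendsto.const_mul
        (1 * ‖s‖)⁻¹).mono_left (nhdsWithin_le_nhds (s := Ioi 0))
      simpa [Real.zero_rpow h.ne'] using this
  · refine squeeze_zero_norm' (a := fun x => (-(s.re / 2) * ‖s‖)⁻¹ * x ^ (-(s.re / 2) + s.re)) ?_ ?_
    · filter_upwards [Filter.eventually_gt_atTop 0] with x hx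
      exact norm_log_one_add_mul_cpow_le hx (by linarith) (by linarith)
    · have := (tendsto_rpow_neg_atTop (y := -(s.re / 2)) (by linarith)).const_mul
        (-(s.re / 2) * ‖s‖)⁻¹
      rw [mul_zero] at this
      convert! this using 4
      ring

/-! ### Vertical integrability and Mellin inversion -/

/-- Both bounds come from `|sin (x + iy)|² = sin² x + sinh² y`. -/
theorem norm_sin_add_mul_I_ge (x y : ℝ) :
    |Real.sin x| ≤ ‖Complex.sin (x + y * Complex.I)‖ ∧ |y| ≤ ‖Complex.sin (x + y * Complex.I)‖ := by
  have hsq : ‖Complex.sin (x + y * Complex.I)‖ ^ 2 = Real.sin x ^ 2 + Real.sinh y ^ 2 := by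
    rw [Complex.sin_add_mul_I, ← Complex.ofReal_sin, ← Complex.ofReal_cos, ← Complex.ofReal_sinh,
      ← Complex.ofReal_cosh, ← Complex.ofReal_mul, ← Complex.ofReal_mul, Complex.sq_norm,
      Complex.normSq_add_mul_I, mul_pow, mul_pow, Real.cosh_sq, Real.cos_sq']
    ring
  have hsinh : |y| ≤ |Real.sinh y| := by
    rw [Real.abs_sinh]
    exact Real.self_le_sinh_iff.2 (abs_nonneg y)
  constructor
  · refine abs_le_of_sq_le_sq' ?_ (norm_nonneg _) |> abs_le.2
    nlinarith [sq_nonneg (Real.sinh y)]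
  · refine hsinh.trans (abs_le_of_sq_le_sq' ?_ (norm_nonneg _) |> abs_le.2)
    nlinarith [sq_nonneg (Real.sin x)]

theorem sin_pi_mul_ne_zero_of_neg_one_lt_re {s : ℂ} (hs : -1 < s.re) (hs0 : s.re < 0) :
    Complex.sin (Real.pi * s) ≠ 0 := by
  rw [Complex.sin_ne_zero_iff]
  intro k hk
  have hk' : s = k := by
    have : (Real.pi : ℂ) ≠ 0 := by exact_mod_cast Real.pi_ne_zero
    exact mul_left_cancel₀ this (by rw [hk]; ring)
  subst hk'
  simp only [Complex.intCast_re] at hs hs0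
  have h1 : -1 < k := by exact_mod_cast hs
  have h2 : k < 0 := by exact_mod_cast hs0
  omega

theorem integrable_inv_mul_sin {σ : ℝ} (hs : -1 < σ) (hs0 : σ < 0) :
    Integrable fun y : ℝ => (Real.pi : ℂ) /
      (((σ : ℂ) + y * Complex.I) * Complex.sin (Real.pi * ((σ : ℂ) + y * Complex.I))) := by
  have hsin : Real.sin (Real.pi * σ) ≠ 0 := by
    have := sin_pi_mul_ne_zero_of_neg_one_lt_re (s := σ) (by simpa) (by simpa)
    exact_mod_cast this
  -- The denominator has modulus at least `m` and at least `m * y ^ 2`, hence at least `m * (1 + y ^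
  -- 2) / 2`; quadratic decay suffices.
  set m : ℝ := min (|σ| * |Real.sin (Real.pi * σ)|) Real.pi with hm
  have hm0 : 0 < m := lt_min (mul_pos (abs_pos.2 hs0.ne) (abs_pos.2 hsin)) Real.pi_pos
  refine Integrable.mono' (integrable_inv_one_add_sq.const_mul (Real.pi * 2 / m)) ?_ ?_
  · refine Continuous.aestronglyMeasurable (Continuous.div (by fun_prop) (by fun_prop) fun y => ?_)
    refine mul_ne_zero (fun h => hs0.ne ?_) (sin_pi_mul_ne_zero_of_neg_one_lt_re (by simpa) (by simpa))
    simpa using congrArg Complex.re h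
  · refine Filter.Eventually.of_forall fun y => ?_
    obtain ⟨h1, h2⟩ := norm_sin_add_mul_I_ge (Real.pi * σ) (Real.pi * y)
    rw [show ((Real.pi * σ : ℝ) : ℂ) + ((Real.pi * y : ℝ) : ℂ) * Complex.I =
      Real.pi * ((σ : ℂ) + y * Complex.I) by push_cast; ring] at h1 h2
    have h3 : |σ| ≤ ‖(σ : ℂ) + y * Complex.I‖ := by
      simpa using Complex.abs_re_le_norm ((σ : ℂ) + y * Complex.I)
    have h4 : |y| ≤ ‖(σ : ℂ) + y * Complex.I‖ := by
      simpa using Complex.abs_im_le_norm ((σ : ℂ) + y * Complex.I)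
    rw [norm_div, norm_mul, Complex.norm_real, Real.norm_of_nonneg Real.pi_pos.le]
    set A := ‖(σ : ℂ) + y * Complex.I‖
    set B := ‖Complex.sin (Real.pi * ((σ : ℂ) + y * Complex.I))‖
    have h5 : m ≤ A * B := (min_le_left _ _).trans (by gcongr)
    have h6 : m * y ^ 2 ≤ A * B := by
      calc m * y ^ 2 ≤ Real.pi * y ^ 2 := by gcongr; exact min_le_right _ _
        _ = |y| * |Real.pi * y| := by
          rw [abs_mul, abs_of_pos Real.pi_pos, ← sq_abs]; ring
        _ ≤ A * B := by gcongr
    rw [← div_eq_mul_inv, div_div, div_le_div_iff₀ (hm0.trans_le h5) (by positivity)]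
    nlinarith [Real.pi_pos]

theorem mellinInv_inv_mul_sin {σ x : ℝ} (hs : -1 < σ) (hs0 : σ < 0) (hx : 0 < x) :
    (1 / (2 * Real.pi) : ℂ) * ∫ y : ℝ, (x : ℂ) ^ (-((σ : ℂ) + y * Complex.I)) * ((Real.pi : ℂ) /
      (((σ : ℂ) + y * Complex.I) * Complex.sin (Real.pi * ((σ : ℂ) + y * Complex.I)))) =
      Real.log (1 + x) := by
  have hM : ∀ y : ℝ, mellin (fun x : ℝ => ((Real.log (1 + x) : ℝ) : ℂ)) (σ + y * Complex.I) =
      (Real.pi : ℂ) /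
      (((σ : ℂ) + y * Complex.I) * Complex.sin (Real.pi * ((σ : ℂ) + y * Complex.I))) :=
    fun y => (hasMellin_log_one_add (by simpa) (by simpa)).2
  have := mellinInv_mellin_eq σ (fun x : ℝ => ((Real.log (1 + x) : ℝ) : ℂ)) hx
    (mellinConvergent_log_one_add (by simpa) (by simpa))
    (by simpa only [Complex.VerticalIntegrable, hM] using! integrable_inv_mul_sin hs hs0)
    (Complex.continuous_ofReal.continuousAt.comp
      (ContinuousAt.log (by fun_prop) (by positivity)))
  rw [← this, mellinInv]
  simp only [hM, smul_eq_mul, Complex.real_smul]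
  push_cast
  rfl

/-! ### Fractional moments of the density -/

/-- The substitution `u = w x ^ α` reduces this to the Beta integral at `s + 1` with `a = lam + 1`;
the factor `lam` is absorbed by `Γ(lam + 1) = lam Γ(lam)`. -/
theorem integral_cpow_mul_lomax {α lam w : ℝ} (hα : 0 < α) (hlam : 0 < lam) (hw : 0 < w) {s : ℂ}
    (hs : -1 < s.re) (hsl : s.re < lam) :
    IntegrableOn (fun x : ℝ => (x : ℂ) ^ (α * s) *
      ((α * lam * w * x ^ (α - 1) * (1 + w * x ^ α) ^ (-(lam + 1)) : ℝ) : ℂ)) (Ioi 0) ∧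
    ∫ x in Ioi (0 : ℝ), (x : ℂ) ^ (α * s) *
      ((α * lam * w * x ^ (α - 1) * (1 + w * x ^ α) ^ (-(lam + 1)) : ℝ) : ℂ) =
      (w : ℂ) ^ (-s) * (Complex.Gamma (1 + s) * Complex.Gamma (lam - s)) / Complex.Gamma lam := by
  have hαc : (α : ℂ) ≠ 0 := by exact_mod_cast hα.ne'
  have hwc : (w : ℂ) ≠ 0 := by exact_mod_cast hw.ne'
  have hlc : (lam : ℂ) ≠ 0 := by exact_mod_cast hlam.ne'
  obtain ⟨hc, hm⟩ := hasMellin_one_add_rpow_neg (a := lam + 1) (s := s + 1)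
    (by simp; linarith) (by simpa)
  have hS : (α * s + α : ℂ) / α = s + 1 := by field_simp
  have hc' := (MellinConvergent.comp_rpow (s := α * s + α) hα.ne').2
    (hS ▸ (MellinConvergent.comp_mul_left hw).2 hc)
  have hm' := mellin_comp_rpow
    (fun t : ℝ => (((1 + w * t) ^ (-(lam + 1)) : ℝ) : ℂ)) (α * s + α) α
  rw [hS, mellin_comp_mul_left (fun t : ℝ => (((1 + t) ^ (-(lam + 1)) : ℝ) : ℂ)) _ hw, hm] at hm'
  have hcongr : ∀ x ∈ Ioi (0 : ℝ), (α * lam * w : ℂ) *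
      ((x : ℂ) ^ (α * s + α - 1 : ℂ) • (((1 + w * x ^ α) ^ (-(lam + 1)) : ℝ) : ℂ)) =
      (x : ℂ) ^ (α * s) *
      ((α * lam * w * x ^ (α - 1) * (1 + w * x ^ α) ^ (-(lam + 1)) : ℝ) : ℂ) := by
    intro x hx
    have hx : 0 < x := hx
    have hxc : (x : ℂ) ≠ 0 := by exact_mod_cast hx.ne'
    rw [add_sub_assoc, Complex.cpow_add _ _ hxc, smul_eq_mul]
    push_cast [Complex.ofReal_cpow hx.le]
    ring
  refine ⟨IntegrableOn.congr_fun (Integrable.const_mul hc' (α * lam * w : ℂ)) hcongr measurableSet_Ioi, ?_⟩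
  rw [← setIntegral_congr_fun measurableSet_Ioi hcongr, integral_const_mul]
  rw [mellin] at hm'
  rw [hm', abs_of_pos hα, Complex.real_smul, smul_eq_mul, neg_add,
    Complex.cpow_add _ _ hwc, Complex.cpow_neg_one, add_comm s 1]
  push_cast
  rw [Complex.Gamma_add_one _ hlc, show (lam : ℂ) + 1 - (1 + s) = lam - s by ring]
  have := Complex.Gamma_ne_zero_of_re_pos (s := lam) (by simpa)
  field_simp

theorem integrableOn_rpow_mul_lomax {α lam w c : ℝ} (hα : 0 < α) (hlam : 0 < lam) (hw : 0 < w)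
    (hc : -1 < c) (hcl : c < lam) :
    IntegrableOn (fun x : ℝ => x ^ (α * c) *
      (α * lam * w * x ^ (α - 1) * (1 + w * x ^ α) ^ (-(lam + 1)))) (Ioi 0) := by
  have h := (integral_cpow_mul_lomax hα hlam hw (s := c) (by simpa) (by simpa)).1.re
  refine IntegrableOn.congr_fun h (fun x hx => ?_) measurableSet_Ioi
  have hx : 0 < x := hx
  simp only [← Complex.ofReal_mul, ← Complex.ofReal_cpow hx.le, RCLike.re_to_complex,
    Complex.ofReal_re]

theorem lomax_nonneg {α lam w x : ℝ} (hα : 0 < α) (hlam : 0 < lam) (hw : 0 < w) (hx : 0 < x) :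
    0 ≤ α * lam * w * x ^ (α - 1) * (1 + w * x ^ α) ^ (-(lam + 1)) := by positivity

theorem integrableOn_log_mul_lomax {α lam w : ℝ} (hα : 0 < α) (hlam : 1 / α < lam) (hw : 0 < w) :
    IntegrableOn (fun x : ℝ => Real.log (1 + x) *
      (α * lam * w * x ^ (α - 1) * (1 + w * x ^ α) ^ (-(lam + 1)))) (Ioi 0) := by
  have hl : 0 < lam := lt_trans (by positivity) hlam
  -- Since `log (1 + x) ≤ x`, a finite mean suffices; it is the moment `c = 1 / α`, and this is
  -- where `1 / α < lam` enters.
  have h := integrableOn_rpow_mul_lomax (c := 1 / α) hα hl hw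
    (lt_trans (by norm_num) (one_div_pos.2 hα)) hlam
  refine Integrable.mono' h ?_ ?_
  · exact Measurable.aestronglyMeasurable (by fun_prop)
  · filter_upwards [ae_restrict_mem measurableSet_Ioi] with x hx
    have hx : 0 < x := hx
    rw [norm_mul, Real.norm_of_nonneg (lomax_nonneg hα hl hw hx), mul_one_div_cancel hα.ne']
    refine mul_le_mul_of_nonneg_right ?_ (lomax_nonneg hα hl hw hx)
    simpa [abs_of_pos hx] using norm_log_one_add_le_rpow_div hx.le one_pos le_rfl

/-! ### The Fox kernel and its separating lines -/

/-- The factor of the Mellin-Barnes kernel that comes from the Mellin transform of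
`x ↦ log (1 + x)`. -/
noncomputable def logKernel (α : ℝ) (s : ℂ) : ℂ :=
  Real.pi / (α * s * Complex.sin (Real.pi * (α * s)))

/-- The function `s sin πs` is even, so the substitution `s ↦ -αs`, which takes `Re s = c` to `Re s
= -αc` in the strip of inversion, introduces no sign. -/
theorem logKernel_neg_mul (α c t : ℝ) :
    (Real.pi : ℂ) / ((((-(α * c) : ℝ) : ℂ) + ((-α * t : ℝ) : ℂ) * Complex.I) *
      Complex.sin (Real.pi * (((-(α * c) : ℝ) : ℂ) + ((-α * t : ℝ) : ℂ) * Complex.I))) =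
      logKernel α (c + t * Complex.I) := by
  have : (((-(α * c) : ℝ) : ℂ) + ((-α * t : ℝ) : ℂ) * Complex.I) =
    -(α * (c + t * Complex.I)) := by push_cast; ring
  rw [this, mul_neg, Complex.sin_neg, neg_mul_neg, logKernel]

theorem integrable_logKernel {α c : ℝ} (hα : 0 < α) (hc : 0 < c) (hcα : c < 1 / α) :
    Integrable fun t : ℝ => logKernel α (c + t * Complex.I) := by
  have hcα' : α * c < 1 := by rwa [lt_div_iff₀ hα, mul_comm] at hcα
  have := (integrable_inv_mul_sin (σ := -(α * c)) (by linarith)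
    (by simpa using mul_pos hα hc)).comp_mul_left' (neg_ne_zero.2 hα.ne')
  simpa only [logKernel_neg_mul] using this

theorem integral_cpow_mul_logKernel {α c x : ℝ} (hα : 0 < α) (hc : 0 < c) (hcα : c < 1 / α)
    (hx : 0 < x) :
    ∫ t : ℝ, (x : ℂ) ^ (α * ((c : ℂ) + t * Complex.I)) * logKernel α (c + t * Complex.I) =
      2 * Real.pi / α * Real.log (1 + x) := by
  have hcα' : α * c < 1 := by rwa [lt_div_iff₀ hα, mul_comm] at hcα
  have hαc : (α : ℂ) ≠ 0 := by exact_mod_cast hα.ne'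
  have hinv := mellinInv_inv_mul_sin (σ := -(α * c)) (by linarith)
    (by simpa using mul_pos hα hc) hx
  have hsub := Measure.integral_comp_mul_left
    (fun y : ℝ => (x : ℂ) ^ (-(((-(α * c) : ℝ) : ℂ) + y * Complex.I)) * ((Real.pi : ℂ) /
      ((((-(α * c) : ℝ) : ℂ) + y * Complex.I) *
        Complex.sin (Real.pi * (((-(α * c) : ℝ) : ℂ) + y * Complex.I))))) (-α)
  simp only [logKernel_neg_mul] at hsub
  have he : ∀ t : ℝ, -(((-(α * c) : ℝ) : ℂ) + ((-α * t : ℝ) : ℂ) * Complex.I) =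
    α * (c + t * Complex.I) := fun t => by push_cast; ring
  simp only [he] at hsub
  rw [hsub, ← hinv, abs_inv, abs_neg, abs_of_pos hα, Complex.real_smul, Complex.ofReal_inv,
    ← mul_assoc]
  have : (Real.pi : ℂ) ≠ 0 := by exact_mod_cast Real.pi_ne_zero
  congr 1
  field_simp

/-- The binding poles are `s = 0` of `Γ(αs)` and `s = 1/α` of `Γ(1 - αs)`. Those of `Γ(1 + s)` start
at `-1`, and those of `Γ(lam - s)` at `lam > 1/α`. -/
theorem foxHSeparates_capacity_iff {α lam c : ℝ} (hα : 0 < α) (hlam : 1 / α < lam) :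
    FoxHSeparates 3 2
      ![((1 - lam : ℂ), (1 : ℝ)), ((0 : ℂ), α), ((1 : ℂ), α)]
      ![((1 : ℂ), (1 : ℝ)), ((0 : ℂ), α), ((0 : ℂ), α)] c ↔ 0 < c ∧ c < 1 / α := by
  have hαc : (α : ℂ) ≠ 0 := by exact_mod_cast hα.ne'
  constructor
  · rintro ⟨h1, h2⟩
    constructor
    · simpa using h1 1 (by norm_num) 0 0 (by simp)
    · have := h2 1 (by norm_num) 0 ((1 / α : ℝ) : ℂ) (by simp [hαc])
      rwa [Complex.ofReal_re] at this
  · rintro ⟨h1, h2⟩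
    constructor
    · have key : ∀ (k : ℕ) (s : ℂ), 0 + (α : ℂ) * s = -k → s.re < c := by
        intro k s h
        have := congrArg Complex.re h
        simp at this
        nlinarith [k.cast_nonneg (α := ℝ)]
      intro j _ k s h
      fin_cases j
      · have := congrArg Complex.re h
        simp at this
        linarith [k.cast_nonneg (α := ℝ)]
      · exact key k s h
      · exact key k s h
    · intro j hj k s h
      fin_cases j
      · have := congrArg Complex.re h
        simp at this
        linarith [k.cast_nonneg (α := ℝ)]
      · have := congrArg Complex.re h
        simp at this
        refine h2.trans_le ?_
        rw [div_le_iff₀ hα]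
        linarith [k.cast_nonneg (α := ℝ)]
      · simp at hj

/-- One `Γ(αs)` cancels against `Γ(αs + 1) = αs Γ(αs)`; the other pairs with `Γ(1 - αs)` by
reflection. -/
theorem foxHKernel_capacity {α lam : ℝ} {s : ℂ} (hα : α ≠ 0) (hs : s ≠ 0) :
    foxHKernel 3 2
      ![((1 - lam : ℂ), (1 : ℝ)), ((0 : ℂ), α), ((1 : ℂ), α)]
      ![((1 : ℂ), (1 : ℝ)), ((0 : ℂ), α), ((0 : ℂ), α)] s =
      logKernel α s * (Complex.Gamma (1 + s) * Complex.Gamma (lam - s)) := by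
  have hαs : (α : ℂ) * s ≠ 0 := mul_ne_zero (by exact_mod_cast hα) hs
  have h1 : foxHKernel 3 2
      ![((1 - lam : ℂ), (1 : ℝ)), ((0 : ℂ), α), ((1 : ℂ), α)]
      ![((1 : ℂ), (1 : ℝ)), ((0 : ℂ), α), ((0 : ℂ), α)] s =
      (Complex.Gamma (1 + s) * Complex.Gamma (α * s) * Complex.Gamma (α * s)) *
        (Complex.Gamma (lam - s) * Complex.Gamma (1 - α * s)) / Complex.Gamma (α * s + 1) := by
    simp [foxHKernel, Finset.prod_filter, Fin.prod_univ_three, add_comm]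
  have h2 := Complex.Gamma_mul_Gamma_one_sub (α * s)
  rw [h1, Complex.Gamma_add_one _ hαs, logKernel, mul_comm (α * s : ℂ) (Complex.sin _), ← div_div (Real.pi : ℂ), ← h2]
  field_simp

/-! ### Fubini and the capacity formula -/

/-- On the line, `|x ^ (αs)| = x ^ (αc)` does not depend on `t`, so the norm splits into a function
of `t` times a function of `x`, each integrable. -/
theorem integrable_logKernel_mul_lomax {α lam w c : ℝ} (hα : 0 < α) (hlam : 1 / α < lam)
    (hw : 0 < w) (hc : 0 < c) (hcα : c < 1 / α) :
    Integrable (fun z : ℝ × ℝ => logKernel α (c + z.1 * Complex.I) *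
      ((z.2 : ℂ) ^ (α * ((c : ℂ) + z.1 * Complex.I)) *
        ((α * lam * w * z.2 ^ (α - 1) * (1 + w * z.2 ^ α) ^ (-(lam + 1)) : ℝ) : ℂ)))
      (volume.prod (volume.restrict (Ioi 0))) := by
  have hl : 0 < lam := lt_trans (by positivity) hlam
  refine Integrable.mono' ((integrable_logKernel hα hc hcα).norm.mul_prod
    (integrableOn_rpow_mul_lomax (c := c) hα hl hw (by linarith) (hcα.trans hlam))) ?_ ?_
  · refine Measurable.aestronglyMeasurable ?_
    unfold logKernel
    fun_prop
  · have hpos : ∀ᵐ z : ℝ × ℝ ∂(volume : Measure ℝ).prod (volume.restrict (Ioi 0)), 0 < z.2 :=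
      Measure.quasiMeasurePreserving_snd.ae (ae_restrict_mem measurableSet_Ioi)
    filter_upwards [hpos] with z hz
    rw [norm_mul, norm_mul, Complex.norm_real, Complex.norm_cpow_eq_rpow_re_of_pos hz,
      Real.norm_of_nonneg (lomax_nonneg hα hl hw hz)]
    simp

theorem hasFoxH_capacity {α lam w : ℝ} (hα : 0 < α) (hlam : 1 / α < lam) (hw : 0 < w) :
    HasFoxH 3 2
      ![((1 - lam : ℂ), (1 : ℝ)), ((0 : ℂ), α), ((1 : ℂ), α)]
      ![((1 : ℂ), (1 : ℝ)), ((0 : ℂ), α), ((0 : ℂ), α)] (w : ℂ)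
      ((Real.Gamma lam / α * ∫ x in Ioi (0 : ℝ), Real.log (1 + x) *
        (α * lam * w * x ^ (α - 1) * (1 + w * x ^ α) ^ (-(lam + 1))) : ℝ) : ℂ) := by
  have hl : 0 < lam := lt_trans (by positivity) hlam
  have hGl : Complex.Gamma lam ≠ 0 := Complex.Gamma_ne_zero_of_re_pos (by simpa)
  refine ⟨⟨1 / α / 2, (foxHSeparates_capacity_iff hα hlam).2
    ⟨by positivity, half_lt_self (by positivity)⟩⟩, fun c hsep => ?_⟩
  obtain ⟨hc, hcα⟩ := (foxHSeparates_capacity_iff hα hlam).1 hsep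
  set p : ℝ → ℝ := fun x => α * lam * w * x ^ (α - 1) * (1 + w * x ^ α) ^ (-(lam + 1)) with hp
  have hF := integrable_logKernel_mul_lomax hα hlam hw hc hcα
  have hEq : foxHIntegrand 3 2
      ![((1 - lam : ℂ), (1 : ℝ)), ((0 : ℂ), α), ((1 : ℂ), α)]
      ![((1 : ℂ), (1 : ℝ)), ((0 : ℂ), α), ((0 : ℂ), α)] (w : ℂ) c =
      fun t : ℝ => (∫ x in Ioi (0 : ℝ), logKernel α (c + t * Complex.I) *
        ((x : ℂ) ^ (α * ((c : ℂ) + t * Complex.I)) * (p x : ℂ))) *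
        (Complex.Gamma lam * Complex.I) := by
    funext t
    have hre : ((c : ℂ) + t * Complex.I).re = c := by simp
    have hs : ((c : ℂ) + t * Complex.I) ≠ 0 := by
      intro h
      rw [h] at hre
      exact hc.ne hre
    rw [integral_const_mul, (integral_cpow_mul_lomax hα hl hw (by rw [hre]; linarith)
      (by rw [hre]; linarith)).2, foxHIntegrand, foxHKernel_capacity hα.ne' hs]
    field_simp
  rw [hEq]
  -- As a partial integral of a jointly integrable function, the Mellin–Barnes integrand is
  -- absolutely integrable without any Gamma-function asymptotics.
  refine ⟨hF.integral_prod_left.mul_const _, ?_⟩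
  rw [integral_mul_const, integral_integral_swap hF]
  have hin : ∀ x ∈ Ioi (0 : ℝ), (∫ t : ℝ, logKernel α (c + t * Complex.I) *
        ((x : ℂ) ^ (α * ((c : ℂ) + t * Complex.I)) * (p x : ℂ))) =
      2 * Real.pi / α * ((Real.log (1 + x) * p x : ℝ) : ℂ) := by
    intro x hx
    rw [Complex.ofReal_mul (Real.log (1 + x)), ← mul_assoc, ← integral_cpow_mul_logKernel hα hc hcα hx,
      ← integral_mul_const]
    exact integral_congr_ae (Filter.Eventually.of_forall fun t => by ring)
  rw [setIntegral_congr_fun measurableSet_Ioi hin, integral_const_mul, integral_complex_ofReal,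
    Complex.ofReal_mul, Complex.ofReal_div, ← Complex.Gamma_ofReal]
  generalize (∫ x in Ioi (0 : ℝ), Real.log (1 + x) * p x) = C
  have : (Real.pi : ℂ) ≠ 0 := by exact_mod_cast Real.pi_ne_zero
  field_simp

theorem alphaLomaxZeta_pos {α lam : ℝ} (hα : 0 < α) (hlam : 1 / α < lam) :
    0 < alphaLomaxZeta α lam := by
  have h1 : 0 < 1 / α := by positivity
  have := Real.Gamma_pos_of_pos (by linarith : 0 < 1 + 1 / α)
  have := Real.Gamma_pos_of_pos (by linarith : 0 < lam - 1 / α)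
  have := Real.Gamma_pos_of_pos (by linarith : 0 < lam)
  unfold alphaLomaxZeta
  positivity

theorem mainTheorem6 (α lam gbar : ℝ) (hα : 0 < α) (hlam : 1 / α < lam) (hgbar : 0 < gbar) :
    IntegrableOn (fun γ : ℝ => Real.log (1 + γ) * alphaLomaxSNRPdf α lam gbar γ) (Ioi 0) ∧
    HasFoxH 3 2
      ![((1 - lam : ℂ), (1 : ℝ)), ((0 : ℂ), α), ((1 : ℂ), α)]
      ![((1 : ℂ), (1 : ℝ)), ((0 : ℂ), α), ((0 : ℂ), α)]
      ((alphaLomaxZeta α lam / gbar ^ α : ℝ) : ℂ)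
      (foxH 3 2
        ![((1 - lam : ℂ), (1 : ℝ)), ((0 : ℂ), α), ((1 : ℂ), α)]
        ![((1 : ℂ), (1 : ℝ)), ((0 : ℂ), α), ((0 : ℂ), α)]
        ((alphaLomaxZeta α lam / gbar ^ α : ℝ) : ℂ)) ∧
    (ergodicCapacity (alphaLomaxSNRPdf α lam gbar) : ℂ) =
      ((α / (Real.log 2 * Real.Gamma lam) : ℝ) : ℂ) *
        foxH 3 2
          ![((1 - lam : ℂ), (1 : ℝ)), ((0 : ℂ), α), ((1 : ℂ), α)]
          ![((1 : ℂ), (1 : ℝ)), ((0 : ℂ), α), ((0 : ℂ), α)]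
          ((alphaLomaxZeta α lam / gbar ^ α : ℝ) : ℂ) := by
  set w : ℝ := alphaLomaxZeta α lam / gbar ^ α with hw_def
  have hw : 0 < w := div_pos (alphaLomaxZeta_pos hα hlam) (Real.rpow_pos_of_pos hgbar α)
  have hpdf : alphaLomaxSNRPdf α lam gbar =
      fun x => α * lam * w * x ^ (α - 1) * (1 + w * x ^ α) ^ (-(lam + 1)) := by
    funext x
    rw [alphaLomaxSNRPdf, mul_div_assoc, ← hw_def]
  have hH := hasFoxH_capacity hα hlam hw
  refine ⟨by simpa only [hpdf] using! integrableOn_log_mul_lomax hα hlam hw,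
    hH.foxH_eq.symm ▸ hH, ?_⟩
  have hl : 0 < lam := lt_trans (by positivity) hlam
  have hG : Real.Gamma lam ≠ 0 := (Real.Gamma_pos_of_pos hl).ne'
  rw [hH.foxH_eq, ← Complex.ofReal_mul, ergodicCapacity, hpdf]
  congr 1
  generalize (∫ x in Ioi (0 : ℝ), Real.log (1 + x) *
    (α * lam * w * x ^ (α - 1) * (1 + w * x ^ α) ^ (-(lam + 1)))) = C
  field_simp
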